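/- Let $\mathcal A$ be the vertex set of a web-like graph: there are a finite set $\mathcal C$ of channels and, for each $\nu\in\mathcal C$, vertices $\nu(k)\in\mathcal A$, $k\ge 0$, such that the vertices $\nu(k)$ with $\nu\in\mathcal C$, $k\ge1$, are pairwise distinct, and the inner part $\mathcal A_1=\mathcal A\setminus\{\nu(k):\nu\in\mathcal C,\ k\ge 1\}$ is finite and contains every end point $\nu(0)$. Let $L=(L(\alpha,\beta))_{\alpha,\beta\in\mathcal A}$ be a real symmetric positive semidefinite matrix such that, for every $\nu\in\mathcal C$: - $L(\nu(k),\nu(n))=0$ if $|n-k|>1$, and $L(\nu(k),\nu(k+1))\neq0$ for all $k\ge0$; - $L(\nu(k),\alpha)=0$ for all $k\ge1$ and every vertex $\alpha\notin\{\nu(n):n\ge0\}$. Put $b_\nu(k)=-L(\nu(k),\nu(k+1))$ and $a_\nu(k)=L(\nu(k),\nu(k))$, and assume that for some integer $K_0>0$ we have $b_\nu(k)=1$ and $a_\nu(k)=2$ for all $k\ge K_0$ and all $\nu\in\mathcal C$. Let $u\in C^1([0,1],\ell^2(\mathcal A))$ satisfy $$\partial_t u(t,\alpha)=i\sum_{\beta\in\mathcal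 A}L(\alpha,\beta)\,u(t,\beta),\qquad t\in[0,1],\ \alpha\in\mathcal A .$$ Let $\nu_0\in\mathcal C$. If for some $\epsilon>0$ and some constant $C$ $$|u(t,\nu_0(k))|\le C\Big(\frac{e}{(2+\epsilon)k}\Big)^k\qquad\text{for all integers } k>0 \text{ and both } t\in\{0,1\},$$ then $u(t,\nu_0(k))=0$ for all $t\in[0,1]$ and all $k\ge0$. -/

import Mathlib

/-- A web-like graph on the vertex set `A` with channels indexed by `C`: a finite inner part
(the vertices that are not of the form `chan ν k` with `k ≥ 1`), to which the semi-infinite channels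
`chan ν 0, chan ν 1, chan ν 2, …` are attached at their end points `chan ν 0`, together with the
interaction matrix `L`. Different channels may be attached at the same vertex. -/
structure WebLikeGraph (A C : Type*) where
  /-- `chan ν k` is the vertex `ν(k)` of the channel `ν`. -/
  chan : C → ℕ → A
  /-- The interaction matrix. -/
  L : Matrix A A ℝ
  /-- `L` is real symmetric and positive (semidefinite), tested on finitely supported vectors. -/
  posSemidef : L.PosSemidef
  /-- The vertices `ν(k)`, `k ≥ 1`, of all the channels are pairwise distinct. -/
  chan_succ_inj : ∀ ν σ k n, chan ν (k + 1) = chan σ (n + 1) → ν = σ ∧ k = n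
  /-- The end points `ν(0)` belong to the inner part. -/
  chan_zero_ne : ∀ ν σ n, chan ν 0 ≠ chan σ (n + 1)
  /-- The inner part is finite. -/
  finite_core : {α : A | ∀ ν k, 1 ≤ k → chan ν k ≠ α}.Finite
  /-- Vertices of a channel that are not neighbours along it do not interact. -/
  far : ∀ ν k n, k + 1 < n → L (chan ν k) (chan ν n) = 0
  /-- Consecutive vertices of a channel interact. -/
  near : ∀ ν k, L (chan ν k) (chan ν (k + 1)) ≠ 0
  /-- `ν(k)`, `k ≥ 1`, does not interact with any vertex outside the channel `ν`. -/
  outside : ∀ ν k, 1 ≤ k → ∀ α, α ∉ Set.range (chan ν) → L (chan ν k) α = 0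

namespace WebLikeGraph

/-- The off-diagonal channel coefficients: `-b_ν(k) = L(ν(k), ν(k+1))`. -/
def b {A C : Type*} (G : WebLikeGraph A C) (ν : C) (k : ℕ) : ℝ :=
  -G.L (G.chan ν k) (G.chan ν (k + 1))

/-- The diagonal channel coefficients: `a_ν(k) = L(ν(k), ν(k))`. -/
def a {A C : Type*} (G : WebLikeGraph A C) (ν : C) (k : ℕ) : ℝ :=
  G.L (G.chan ν k) (G.chan ν k)

/-- On every channel the coefficients are `b = 1`, `a = 2` from the index `K₀` on. -/
def StabilizesFrom {A C : Type*} (G : WebLikeGraph A C) (K₀ : ℕ) : Prop :=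
  ∀ ν k, K₀ ≤ k → G.b ν k = 1 ∧ G.a ν k = 2

/-- `u ∈ C¹([0,1], ℓ²(A))` and `∂ₜ u(t,α) = i ∑_β L(α,β) u(t,β)` for all `t ∈ [0,1]` and all
vertices `α`; derivatives at `0` and `1` are one-sided. Each row of `L` has finite support when
there are finitely many channels, so that the sum is then a finite one. -/
structure IsSolution {A C : Type*} (G : WebLikeGraph A C)
    (u : ℝ → lp (fun _ : A => ℂ) 2) : Prop where
  contDiffOn : ContDiffOn ℝ 1 u (Set.Icc 0 1)
  hasDeriv : ∀ t ∈ Set.Icc (0 : ℝ) 1, ∀ α : A,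
    HasDerivWithinAt (fun s => u s α) (Complex.I * ∑' β, (G.L α β : ℂ) * u t β)
      (Set.Icc 0 1) t

end WebLikeGraph

/-!
The argument takes place in `ℓ^∞`, on which `L` acts as a bounded operator `T`, because all but
finitely many rows have at most three non-zero entries, each of modulus at most `2`.

Write `p j = ν₀ (K₀ + j)`, `λ = 2 - z - 1 / z` and `Φ t z = ∑ u(t, p (k + 1)) z ^ k`. The decay at
`t = 0` propagates to all times at any exponential rate (`WebLikeGraph.IsSolution.decay_propagates`),
so `Φ t` is entire. On the channel the equation is the free one, and
`∂ₜ Φ = i (λ Φ - u(t, p 0) + u(t, p 1) / z)`. The boundary terms come from the rest of the graph, and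
the resolvent removes them: `w t = (λ - T)⁻¹ u t` satisfies `∂ₜ w = i (λ w - u)`, so that
`H t z = Φ t z - w(t, p 0) + w(t, p 1) / z`, defined for large `‖z‖`, satisfies `∂ₜ H = i λ H` and
`H 1 = exp (i λ) H 0` (`exp_mul_generating_function_eq`).

By the decay hypothesis `H 0` and `H 1` have exponential type less than `1 / 2` near infinity, while
`exp (i λ)` grows like `exp (Im z)`. Along the positive imaginary axis `H 0` therefore decays faster
than `exp (-‖z‖ / 2)`, and along the negative one it grows more slowly than `exp (‖z‖ / 2)`. By a
Phragmén–Lindelöf argument this forces `H 0 = 0` (`eq_zero_of_type_lt_half`), hence `H t = 0` for all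
`t`. Then `Φ t z = w(t, p 0) - w(t, p 1) / z` tends to zero at infinity, so `Φ t = 0` by Liouville's
theorem. The solution vanishes on the channel beyond `K₀`, and since consecutive vertices interact
the equation carries the vanishing down to the end point.
-/

/-! ### Functions of exponential type -/

/-- Phragmén–Lindelöf in the right half-plane: exponential growth of rate `a` along the positive
real axis, together with exponential decay of rate `δ` along the imaginary axis, improves the growth
along the positive real axis to the rate `a - δ`, with the same constant. -/
theorem norm_le_exp_sub_of_decay_imaginary_axis {f : ℂ → ℂ} {M A δ a : ℝ}
    (hf : DiffContOnCl ℂ f {z | 0 < z.re})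
    (htype : ∀ z : ℂ, 0 ≤ z.re → ‖f z‖ ≤ M * Real.exp (A * ‖z‖))
    (him : ∀ y : ℝ, ‖f (y * Complex.I)‖ ≤ M * Real.exp (-δ * |y|))
    (hre : ∀ x : ℝ, 0 ≤ x → ‖f x‖ ≤ M * Real.exp (a * x)) :
    ∀ x : ℝ, 0 ≤ x → ‖f x‖ ≤ M * Real.exp ((a - δ) * x) := by
  -- Precomposed with `z ↦ l z` and multiplied by `exp (p z)`, `f` still has order at most one,
  -- which is less than the order `2` that the Phragmén–Lindelöf principle allows in a quadrant.
  have growth : ∀ (S : Set ℂ) (l p : ℂ), (∀ z ∈ S, 0 ≤ (l * z).re) →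
      ∃ c < (2 : ℝ), ∃ B, (fun z => f (l * z) * Complex.exp (p * z))
        =O[Bornology.cobounded ℂ ⊓ Filter.principal S] fun z => Real.exp (B * ‖z‖ ^ c) := by
    intro S l p hS
    refine ⟨1, by norm_num, A * ‖l‖ + ‖p‖, ?_⟩
    apply Asymptotics.IsBigO.of_bound M
    filter_upwards [Filter.mem_inf_of_right (Filter.mem_principal_self S)] with z hz
    have h1 := htype (l * z) (hS z hz)
    have h2 : ‖Complex.exp (p * z)‖ ≤ Real.exp (‖p‖ * ‖z‖) := by
      rw [Complex.norm_exp]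
      apply Real.exp_le_exp.mpr
      rw [← norm_mul]
      exact Complex.re_le_norm _
    rw [norm_mul, Real.norm_eq_abs, Real.abs_exp, Real.rpow_one]
    calc _ ≤ (M * Real.exp (A * ‖l * z‖)) * Real.exp (‖p‖ * ‖z‖) := by
          gcongr
          exact (norm_nonneg _).trans h1
      _ = _ := by rw [norm_mul, mul_assoc, ← Real.exp_add]; ring_nf
  have diff : ∀ (S : Set ℂ) (l p : ℂ), (∀ z ∈ S, 0 < (l * z).re) →
      DiffContOnCl ℂ (fun z => f (l * z) * Complex.exp (p * z)) S := by
    intro S l p hS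
    refine DiffContOnCl.smul (c := fun z => f (l * z)) ?_ ?_
    · exact hf.comp (Differentiable.diffContOnCl (by fun_prop)) hS
    · exact Differentiable.diffContOnCl (by fun_prop)
  -- interpolation between the bounds on the two axes, in the first and in the fourth quadrant
  have q1 : ∀ z : ℂ, 0 ≤ z.re → 0 ≤ z.im → ‖f z‖ ≤ M * Real.exp (a * z.re - δ * z.im) := by
    intro z hz1 hz2
    have := PhragmenLindelof.quadrant_I
      (f := fun z => f (1 * z) * Complex.exp ((-a - δ * Complex.I) * z)) (C := M) (z := z)
      (diff _ _ _ (by rintro z ⟨hz, -⟩; simpa using hz))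
      (growth _ _ _ (by rintro z ⟨hz, -⟩; simpa using le_of_lt hz))
      (fun x hx => by
        rw [norm_mul, Complex.norm_exp, one_mul]
        have := mul_le_mul_of_nonneg_right (hre x hx) (Real.exp_pos (-(a * x))).le
        rw [mul_assoc, ← Real.exp_add] at this
        simpa using this)
      (fun x hx => by
        rw [norm_mul, Complex.norm_exp, one_mul]
        have := mul_le_mul_of_nonneg_right (him x) (Real.exp_pos (δ * x)).le
        rw [mul_assoc, ← Real.exp_add, abs_of_nonneg hx] at this
        simpa using this)
      hz1 hz2
    rw [norm_mul, Complex.norm_exp, one_mul, ← le_div_iff₀ (Real.exp_pos _), div_eq_mul_inv,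
      ← Real.exp_neg] at this
    refine this.trans_eq ?_
    congr 2
    simp
    ring
  have q4 : ∀ z : ℂ, 0 ≤ z.re → z.im ≤ 0 → ‖f z‖ ≤ M * Real.exp (a * z.re + δ * z.im) := by
    intro z hz1 hz2
    have := PhragmenLindelof.quadrant_IV
      (f := fun z => f (1 * z) * Complex.exp ((-a + δ * Complex.I) * z)) (C := M) (z := z)
      (diff _ _ _ (by rintro z ⟨hz, -⟩; simpa using hz))
      (growth _ _ _ (by rintro z ⟨hz, -⟩; simpa using le_of_lt hz))
      (fun x hx => by
        rw [norm_mul, Complex.norm_exp, one_mul]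
        have := mul_le_mul_of_nonneg_right (hre x hx) (Real.exp_pos (-(a * x))).le
        rw [mul_assoc, ← Real.exp_add] at this
        simpa using this)
      (fun x hx => by
        rw [norm_mul, Complex.norm_exp, one_mul]
        have := mul_le_mul_of_nonneg_right (him x) (Real.exp_pos (-(δ * x))).le
        rw [mul_assoc, ← Real.exp_add, abs_of_nonpos hx] at this
        simpa using this)
      hz1 hz2
    rw [norm_mul, Complex.norm_exp, one_mul, ← le_div_iff₀ (Real.exp_pos _), div_eq_mul_inv,
      ← Real.exp_neg] at this
    refine this.trans_eq ?_
    congr 2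
    simp
    ring
  intro x hx
  -- The sector `|arg z| < π / 4` is the first quadrant turned by `1 - i`. On its two sides the real
  -- part equals the modulus of the imaginary part, so there `f` has the improved rate `a - δ`.
  have := PhragmenLindelof.quadrant_I
    (f := fun z => f ((1 - Complex.I) * z) * Complex.exp ((-(a - δ) * (1 - Complex.I)) * z))
    (C := M) (z := x * ((1 + Complex.I) / 2))
      (diff _ _ _ (by
        rintro z ⟨hz, hz'⟩
        have : 0 < z.re + z.im := add_pos hz hz'
        simpa using this))
      (growth _ _ _ (by
        rintro z ⟨hz, hz'⟩
        have : 0 < z.re + z.im := add_pos hz hz'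
        simpa using this.le))
      (fun s hs => by
        rw [norm_mul, Complex.norm_exp]
        have h1 := q4 ((1 - Complex.I) * s) (by simpa using hs) (by simpa using hs)
        have := mul_le_mul_of_nonneg_right h1 (Real.exp_pos (-((a - δ) * s))).le
        rw [mul_assoc, ← Real.exp_add] at this
        refine le_trans (le_of_eq ?_) (this.trans_eq ?_)
        · congr 2
          simp
          ring
        · conv_rhs => rw [← mul_one M, ← Real.exp_zero]
          congr 2
          simp
          ring)
      (fun s hs => by
        rw [norm_mul, Complex.norm_exp]
        have h1 := q1 ((1 - Complex.I) * (s * Complex.I)) (by simpa using hs) (by simpa using hs)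
        have := mul_le_mul_of_nonneg_right h1 (Real.exp_pos (-((a - δ) * s))).le
        rw [mul_assoc, ← Real.exp_add] at this
        refine le_trans (le_of_eq ?_) (this.trans_eq ?_)
        · congr 2
          simp
        · conv_rhs => rw [← mul_one M, ← Real.exp_zero]
          congr 2
          simp
          ring)
      (by simpa using hx) (by simpa using hx)
  have e : (1 - Complex.I) * (x * ((1 + Complex.I) / 2)) = x := by
    linear_combination (-x / 2 : ℂ) * Complex.I_sq
  rw [norm_mul, Complex.norm_exp, mul_assoc, e, ← le_div_iff₀ (Real.exp_pos _), div_eq_mul_inv,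
      ← Real.exp_neg] at this
  refine this.trans_eq ?_
  congr 2
  simp
  ring

/-- A function of exponential type in the right half-plane that decays exponentially in both
directions of the imaginary axis vanishes on the positive real axis. -/
theorem eq_zero_of_decay_imaginary_axis {f : ℂ → ℂ} {M A δ : ℝ}
    (hf : DiffContOnCl ℂ f {z | 0 < z.re}) (hδ : 0 < δ)
    (htype : ∀ z : ℂ, 0 ≤ z.re → ‖f z‖ ≤ M * Real.exp (A * ‖z‖))
    (him : ∀ y : ℝ, ‖f (y * Complex.I)‖ ≤ M * Real.exp (-δ * |y|)) (x : ℝ) (hx : 0 < x) :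
    f x = 0 := by
  -- The constant `M` does not change when the growth rate is improved, so the rate can go to `-∞`.
  have key : ∀ n : ℕ, ∀ x : ℝ, 0 ≤ x → ‖f x‖ ≤ M * Real.exp ((A - n * δ) * x) := by
    intro n
    induction n with
    | zero =>
      intro x hx
      simpa [abs_of_nonneg hx] using htype x (by simpa using hx)
    | succ n ih =>
      have := norm_le_exp_sub_of_decay_imaginary_axis hf htype him ih
      intro x hx
      convert this x hx using 4
      push_cast
      ring
  have lim : Filter.Tendsto (fun n : ℕ => M * Real.exp ((A - n * δ) * x)) Filter.atTop
      (nhds (M * 0)) := by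
    apply Filter.Tendsto.const_mul
    apply Real.tendsto_exp_atBot.comp
    apply Filter.Tendsto.atBot_mul_const hx
    simp only [sub_eq_add_neg]
    apply Filter.tendsto_atBot_add_const_left _ A
    apply Filter.tendsto_neg_atTop_atBot.comp
    exact Filter.Tendsto.atTop_mul_const hδ tendsto_natCast_atTop_atTop
  have := ge_of_tendsto' lim (fun n => key n x hx.le)
  rw [mul_zero] at this
  exact norm_le_zero_iff.mp this

theorem isPreconnected_lt_norm {R : ℝ} (hR : 0 < R) : IsPreconnected {z : ℂ | R < ‖z‖} := by
  -- the image of a half-plane under the exponential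
  have : {z : ℂ | R < ‖z‖} = Complex.exp '' {z : ℂ | Real.log R < z.re} := by
    ext z
    constructor
    · intro hz
      have hz' : R < ‖z‖ := hz
      have h0 : z ≠ 0 := norm_pos_iff.mp (hR.trans hz')
      refine ⟨Complex.log z, ?_, Complex.exp_log h0⟩
      simpa [Complex.log_re] using Real.log_lt_log hR hz'
    · rintro ⟨w, hw, rfl⟩
      have hw' : Real.log R < w.re := hw
      simpa [Complex.norm_exp] using (Real.log_lt_iff_lt_exp hR).mp hw'
  rw [this]
  exact (convex_halfSpace_re_gt _).isPreconnected.image _ Complex.continuous_exp.continuousOn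

/-- Uniqueness at infinity: if `g` is holomorphic near infinity, and both `g` and its product with
`exp (i (2 - z - 1 / z))` have exponential type less than `1 / 2`, then `g` is zero. -/
theorem eq_zero_of_type_lt_half {g : ℂ → ℂ} {R D σ : ℝ} (hR : 1 ≤ R)
    (hg : DifferentiableOn ℂ g {z | R < ‖z‖}) (hσ : 0 ≤ σ) (hσ' : σ < 1 / 2)
    (h0 : ∀ z, R < ‖z‖ → ‖g z‖ ≤ D * Real.exp (σ * ‖z‖))
    (h1 : ∀ z, R < ‖z‖ →
      ‖Complex.exp (Complex.I * (2 - z - z⁻¹)) * g z‖ ≤ D * Real.exp (σ * ‖z‖)) :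
    ∀ z, R < ‖z‖ → g z = 0 := by
  have hopen : IsOpen {z : ℂ | R < ‖z‖} := isOpen_lt continuous_const continuous_norm
  set S : ℝ := R + 1 with hS
  have hshift : ∀ z : ℂ, 0 ≤ z.re → R < ‖z + S‖ := by
    intro z hz
    have := Complex.re_le_norm (z + S)
    simp only [Complex.add_re, Complex.ofReal_re] at this
    linarith
  have hD : 0 ≤ D := by
    have h := h0 (0 + S) (hshift 0 le_rfl)
    exact nonneg_of_mul_nonneg_left ((norm_nonneg _).trans h) (Real.exp_pos _)
  have hnorm : ∀ z : ℂ, ‖z + S‖ ≤ ‖z‖ + S := by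
    intro z
    refine (norm_add_le _ _).trans_eq ?_
    rw [Complex.norm_real, Real.norm_of_nonneg (by linarith)]
  -- The factor `exp (- i z / 2)` balances the decay in the two directions of the imaginary axis.
  set f : ℂ → ℂ := fun z => g (z + S) * Complex.exp (-(Complex.I / 2) * z) with hf
  have hdiff : DifferentiableOn ℂ f {z | -1 < z.re} := by
    apply DifferentiableOn.mul
    · apply hg.comp (by fun_prop)
      intro z hz
      have := Complex.re_le_norm (z + S)
      have hz' : -1 < z.re := hz
      simp only [Complex.add_re, Complex.ofReal_re] at this
      show R < ‖z + S‖
      linarith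
    · fun_prop
  have hdcc : DiffContOnCl ℂ f {z | 0 < z.re} := by
    apply DifferentiableOn.diffContOnCl
    apply hdiff.mono
    rw [Complex.closure_setOfPred_lt_re]
    intro z hz
    have hz' : 0 ≤ z.re := hz
    show -1 < z.re
    linarith
  have hexp : ∀ z : ℂ, ‖Complex.exp (-(Complex.I / 2) * z)‖ = Real.exp (z.im / 2) := by
    intro z
    rw [Complex.norm_exp]
    congr 1
    simp
    ring
  set M : ℝ := D * Real.exp (σ * S + 1) with hM
  have htype : ∀ z : ℂ, 0 ≤ z.re → ‖f z‖ ≤ M * Real.exp ((σ + 1 / 2) * ‖z‖) := by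
    intro z hz
    rw [hf, norm_mul, hexp]
    calc _ ≤ (D * Real.exp (σ * ‖z + S‖)) * Real.exp (z.im / 2) := by
          gcongr
          exact h0 _ (hshift z hz)
      _ ≤ (D * Real.exp (σ * (‖z‖ + S))) * Real.exp (‖z‖ / 2) := by
          have := hnorm z
          have := Complex.im_le_norm z
          gcongr
      _ = D * Real.exp (σ * (‖z‖ + S) + ‖z‖ / 2) := by rw [mul_assoc, ← Real.exp_add]
      _ ≤ D * Real.exp ((σ * S + 1) + (σ + 1 / 2) * ‖z‖) := by
          refine mul_le_mul_of_nonneg_left (Real.exp_le_exp.mpr ?_) hD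
          linarith
      _ = _ := by rw [hM, Real.exp_add, mul_assoc]
  have him : ∀ y : ℝ, ‖f (y * Complex.I)‖ ≤ M * Real.exp (-(1 / 2 - σ) * |y|) := by
    intro y
    have hre : 0 ≤ (y * Complex.I : ℂ).re := by simp
    have hn : ‖(y * Complex.I : ℂ)‖ = |y| := by simp
    rw [hf, norm_mul, hexp]
    have hle : ‖g (y * Complex.I + S)‖ ≤ D * Real.exp (σ * (|y| + S) + 1 - max y 0) := by
      have hs := hshift _ hre
      have hnn := hnorm (y * Complex.I)
      rw [hn] at hnn
      rcases le_total y 0 with hy | hy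
      · rw [max_eq_right hy]
        refine (h0 _ hs).trans ?_
        gcongr
        nlinarith [mul_le_mul_of_nonneg_left hnn hσ]
      -- here the hypothesis on the product is used: `exp (i (2 - w - 1 / w))` has modulus at least
      -- `exp (y - 1)`
      · rw [max_eq_left hy]
        have h2 := h1 _ hs
        rw [norm_mul, Complex.norm_exp] at h2
        set w : ℂ := y * Complex.I + S with hw
        have him1 : |(w⁻¹).im| ≤ 1 := by
          refine (Complex.abs_im_le_norm _).trans ?_
          rw [norm_inv]
          exact inv_le_one_of_one_le₀ (by linarith)
        have hre2 : y - 1 ≤ (Complex.I * (2 - w - w⁻¹)).re := by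
          have : (Complex.I * (2 - w - w⁻¹)).re = w.im + (w⁻¹).im := by
            simp [Complex.mul_re, -Complex.inv_im, -Complex.inv_re]
            ring
          have hwim : w.im = y := by simp [hw]
          rw [this, hwim]
          linarith [(abs_le.mp him1).1]
        have h3 : Real.exp (y - 1) * ‖g w‖ ≤ D * Real.exp (σ * (|y| + S)) := by
          calc _ ≤ _ := by gcongr
            _ ≤ _ := h2
            _ ≤ _ := by gcongr
        rw [mul_comm, ← le_div_iff₀ (Real.exp_pos _), mul_div_assoc, ← Real.exp_sub] at h3
        refine h3.trans_eq ?_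
        congr 2
        ring
    calc _ ≤ D * Real.exp (σ * (|y| + S) + 1 - max y 0) * Real.exp (y / 2) := by
          refine mul_le_mul hle (le_of_eq ?_) (Real.exp_pos _).le (by positivity)
          simp
      _ = D * Real.exp (σ * S + 1 + -(1 / 2 - σ) * |y|) := by
          rw [mul_assoc, ← Real.exp_add]
          congr 2
          rcases le_total y 0 with hy | hy
          · rw [max_eq_right hy, abs_of_nonpos hy]; ring
          · rw [max_eq_left hy, abs_of_nonneg hy]; ring
      _ = _ := by rw [hM, Real.exp_add, mul_assoc]
  have hzero : ∀ x : ℝ, 0 < x → g (x + S) = 0 := by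
    intro x hx
    have := eq_zero_of_decay_imaginary_axis hdcc (by linarith) htype him x hx
    simpa [hf] using this
  have hfreq : ∃ᶠ z in nhdsWithin ((1 + S : ℝ) : ℂ) {((1 + S : ℝ) : ℂ)}ᶜ, g z = 0 := by
    have ht : Filter.Tendsto (fun n : ℕ => (((1 + 1 / ((n : ℝ) + 1)) + S : ℝ) : ℂ)) Filter.atTop
        (nhdsWithin ((1 + S : ℝ) : ℂ) {((1 + S : ℝ) : ℂ)}ᶜ) := by
      apply tendsto_nhdsWithin_of_tendsto_nhds_of_eventually_within
      · apply (Complex.continuous_ofReal.tendsto _).comp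
        have := (tendsto_one_div_add_atTop_nhds_zero_nat (𝕜 := ℝ)).const_add 1 |>.add_const S
        simpa using this
      · refine Filter.Eventually.of_forall fun n => ?_
        have : (0 : ℝ) < 1 / ((n : ℝ) + 1) := by positivity
        simp only [Set.mem_compl_iff, Set.mem_singleton_iff, Complex.ofReal_inj]
        linarith
    refine ht.frequently (Filter.Frequently.of_forall fun n => ?_)
    have := hzero (1 + 1 / ((n : ℝ) + 1)) (by positivity)
    push_cast at this ⊢
    exact this
  have hmem : ((1 + S : ℝ) : ℂ) ∈ {z : ℂ | R < ‖z‖} := by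
    have := hshift 1 (by simp)
    simpa using this
  intro z hz
  exact (hg.analyticOnNhd hopen).eqOn_zero_of_preconnected_of_frequently_eq_zero
    (isPreconnected_lt_norm (by linarith)) hmem hfreq hz

/-! ### Operators on `ℓ²` and `ℓ^∞` -/

/-- Pointwise multiplication by a bounded weight, as a map from `ℓ²` to `ℓ^∞`. -/
theorem exists_mul_l2_to_linfty {A : Type*} (w : A → ℝ) {W : ℝ} (hW : 0 ≤ W)
    (hw : ∀ α, |w α| ≤ W) :
    ∃ D : lp (fun _ : A => ℂ) 2 →L[ℂ] lp (fun _ : A => ℂ) ⊤,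
      ∀ x α, D x α = w α * x α := by
  have hle : ∀ (x : lp (fun _ : A => ℂ) 2) α, ‖(w α : ℂ) * x α‖ ≤ W * ‖x‖ := by
    intro x α
    rw [norm_mul, Complex.norm_real]
    exact mul_le_mul (hw α) (lp.norm_apply_le_norm two_ne_zero x α) (norm_nonneg _) hW
  refine ⟨LinearMap.mkContinuous
    { toFun := fun x => ⟨fun α => (w α : ℂ) * x α,
        memℓp_infty ⟨W * ‖x‖, by rintro _ ⟨α, rfl⟩; exact hle x α⟩⟩
      map_add' := fun x y => by ext α; exact mul_add _ _ _
      map_smul' := fun c x => by ext α; simp; ring } W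
    (fun x => lp.norm_le_of_forall_le (by positivity) (hle x)), fun x α => rfl⟩

/-- A matrix with finitely supported rows and bounded absolute row sums acts on `ℓ^∞`. -/
theorem exists_linfty_operator {A : Type*} (L : Matrix A A ℝ) {B : ℝ} (hB : 0 ≤ B)
    (hL : ∀ α, ∃ s : Finset A, (∀ β ∉ s, L α β = 0) ∧ ∑ β ∈ s, |L α β| ≤ B) :
    ∃ T : lp (fun _ : A => ℂ) ⊤ →L[ℂ] lp (fun _ : A => ℂ) ⊤,
      ∀ x α, T x α = ∑' β, (L α β : ℂ) * x β := by
  choose s hs hsum using hL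
  have hfin : ∀ (x : A → ℂ) α, ∑' β, (L α β : ℂ) * x β = ∑ β ∈ s α, (L α β : ℂ) * x β :=
    fun x α => tsum_eq_sum fun β hβ => by simp [hs α β hβ]
  have hle : ∀ (x : lp (fun _ : A => ℂ) ⊤) α, ‖∑' β, (L α β : ℂ) * x β‖ ≤ B * ‖x‖ := by
    intro x α
    rw [hfin]
    calc _ ≤ ∑ β ∈ s α, ‖(L α β : ℂ) * x β‖ := norm_sum_le _ _
      _ ≤ ∑ β ∈ s α, |L α β| * ‖x‖ := by
          gcongr with β
          rw [norm_mul, Complex.norm_real]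
          exact mul_le_mul_of_nonneg_left (lp.norm_apply_le_norm (by simp) x β) (norm_nonneg _)
      _ = (∑ β ∈ s α, |L α β|) * ‖x‖ := (Finset.sum_mul ..).symm
      _ ≤ _ := mul_le_mul_of_nonneg_right (hsum α) (norm_nonneg _)
  refine ⟨LinearMap.mkContinuous
    { toFun := fun x => ⟨fun α => ∑' β, (L α β : ℂ) * x β,
        memℓp_infty ⟨B * ‖x‖, by rintro _ ⟨α, rfl⟩; exact hle x α⟩⟩
      map_add' := fun x y => by
        ext α
        have h := hfin (x + y) α
        simp only [Pi.add_apply, mul_add, Finset.sum_add_distrib] at h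
        simpa only [lp.coeFn_add, Pi.add_apply, hfin, mul_add] using h
      map_smul' := fun c x => by
        ext α
        simp only [lp.coeFn_smul, Pi.smul_apply, hfin, smul_eq_mul, RingHom.id_apply,
          Finset.mul_sum]
        exact Finset.sum_congr rfl fun β _ => by ring } B
    (fun x => lp.norm_le_of_forall_le (by positivity) (hle x)), fun x α => rfl⟩

theorem hasDerivWithinAt_l2_to_linfty {A : Type*}
    {u : ℝ → lp (fun _ : A => ℂ) 2} {D : lp (fun _ : A => ℂ) 2 →L[ℂ] lp (fun _ : A => ℂ) ⊤} {t : ℝ}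
    {u' : lp (fun _ : A => ℂ) 2} {s : Set ℝ} (h : HasDerivWithinAt u u' s t) :
    HasDerivWithinAt (fun t => D (u t)) (D u') s t :=
  ((D.restrictScalars ℝ).hasFDerivAt).comp_hasDerivWithinAt t h

/-! ### The matrix of a web-like graph and its channels -/

namespace WebLikeGraph

variable {A C : Type*} (G : WebLikeGraph A C)

theorem L_symm (α β : A) : G.L α β = G.L β α := by
  simpa using (G.posSemidef.isHermitian.apply α β).symm

theorem chan_injective (ν : C) : Function.Injective (G.chan ν) := by
  intro k n h
  match k, n with
  | 0, 0 => rfl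
  | 0, n + 1 => exact absurd h (G.chan_zero_ne ν ν n)
  | k + 1, 0 => exact absurd h.symm (G.chan_zero_ne ν ν k)
  | k + 1, n + 1 => rw [(G.chan_succ_inj ν ν k n h).2]

theorem near_of_L_ne_zero {ν : C} {k n : ℕ} (h : G.L (G.chan ν k) (G.chan ν n) ≠ 0) :
    n ≤ k + 1 ∧ k ≤ n + 1 := by
  constructor
  · by_contra! hlt
    exact h (G.far ν k n hlt)
  · by_contra! hlt
    exact h (by rw [G.L_symm]; exact G.far ν n k hlt)

theorem L_chan_succ_ne_zero {ν : C} {k : ℕ} {β : A} (h : G.L (G.chan ν (k + 1)) β ≠ 0) :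
    β = G.chan ν k ∨ β = G.chan ν (k + 1) ∨ β = G.chan ν (k + 2) := by
  have hβ : β ∈ Set.range (G.chan ν) := by
    by_contra hβ
    exact h (G.outside ν (k + 1) (by omega) β hβ)
  obtain ⟨n, rfl⟩ := hβ
  have := G.near_of_L_ne_zero h
  obtain rfl | rfl | rfl : n = k ∨ n = k + 1 ∨ n = k + 2 := by omega
  all_goals simp

/-- An inner vertex interacts with inner vertices and with first vertices `σ(1)` of channels only. -/
theorem finite_row [Finite C] (α : A) : {β | G.L α β ≠ 0}.Finite := by
  by_cases hα : ∃ ν k, α = G.chan ν (k + 1)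
  · obtain ⟨ν, k, rfl⟩ := hα
    refine Set.Finite.subset (s := {G.chan ν k, G.chan ν (k + 1), G.chan ν (k + 2)})
      (by simp) ?_
    intro β hβ
    simpa using G.L_chan_succ_ne_zero hβ
  · refine Set.Finite.subset (G.finite_core.union (Set.finite_range fun σ => G.chan σ 1)) ?_
    intro β hβ
    have hne : G.L α β ≠ 0 := hβ
    by_cases hc : ∀ ν k, 1 ≤ k → G.chan ν k ≠ β
    · exact Or.inl hc
    · push Not at hc
      obtain ⟨σ, k, hk, rfl⟩ := hc
      obtain ⟨n, rfl⟩ : ∃ n, k = n + 1 := ⟨k - 1, by omega⟩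
      rw [G.L_symm] at hne
      rcases G.L_chan_succ_ne_zero hne with h | h | h
      · match n with
        | 0 => exact Or.inr ⟨σ, rfl⟩
        | n + 1 => exact absurd ⟨σ, n, h⟩ hα
      · exact absurd ⟨σ, n, h⟩ hα
      · exact absurd ⟨σ, n + 1, h⟩ hα

/-- The absolute row sums of `L` are bounded: all but finitely many rows have at most three
non-zero entries, each of modulus at most `2`. -/
theorem exists_row_bound [Finite C] {K₀ : ℕ} (hstab : G.StabilizesFrom K₀) :
    ∃ B : ℝ, 0 ≤ B ∧
      ∀ α, ∃ s : Finset A, (∀ β ∉ s, G.L α β = 0) ∧ ∑ β ∈ s, |G.L α β| ≤ B := by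
  set r : A → ℝ := fun α => ∑ β ∈ (G.finite_row α).toFinset, |G.L α β| with hr
  have hfin : {α | ¬ ∃ ν k, K₀ ≤ k ∧ α = G.chan ν (k + 1)}.Finite := by
    refine Set.Finite.subset (G.finite_core.union
      (Set.finite_iUnion fun ν => (Set.finite_Iic K₀).image (G.chan ν))) ?_
    intro α hα
    by_cases hc : ∀ ν k, 1 ≤ k → G.chan ν k ≠ α
    · exact Or.inl hc
    · push Not at hc
      obtain ⟨ν, k, hk, rfl⟩ := hc
      refine Or.inr (Set.mem_iUnion.mpr ⟨ν, k, ?_, rfl⟩)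
      by_contra hK
      have hK' : ¬ k ≤ K₀ := hK
      exact hα ⟨ν, k - 1, by omega, by congr 1; omega⟩
  obtain ⟨B, hB⟩ := (hfin.image r).bddAbove
  refine ⟨max B 6, by positivity, fun α => ⟨(G.finite_row α).toFinset, fun β hβ => ?_, ?_⟩⟩
  · simpa using hβ
  · by_cases hα : ∃ ν k, K₀ ≤ k ∧ α = G.chan ν (k + 1)
    · obtain ⟨ν, k, hk, rfl⟩ := hα
      classical
      have hsub : (G.finite_row (G.chan ν (k + 1))).toFinset ⊆
          {G.chan ν k, G.chan ν (k + 1), G.chan ν (k + 2)} := by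
        intro β hβ
        simpa using G.L_chan_succ_ne_zero (by simpa using hβ)
      have h2 : ∀ β ∈ (G.finite_row (G.chan ν (k + 1))).toFinset,
          |G.L (G.chan ν (k + 1)) β| ≤ 2 := by
        intro β hβ
        have hs := hstab ν k hk
        have hs' := hstab ν (k + 1) (by omega)
        simp only [b, a] at hs hs'
        rcases G.L_chan_succ_ne_zero (by simpa using hβ) with rfl | rfl | rfl
        · rw [G.L_symm, ← abs_neg, hs.1]; norm_num
        · rw [hs'.2]; norm_num
        · rw [← abs_neg, hs'.1]; norm_num
      refine le_max_of_le_right ((Finset.sum_le_card_nsmul _ _ _ h2).trans ?_)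
      have hc := (Finset.card_le_card hsub).trans Finset.card_le_three
      rw [nsmul_eq_mul]
      have : ((G.finite_row (G.chan ν (k + 1))).toFinset.card : ℝ) ≤ 3 := by exact_mod_cast hc
      linarith
    · exact le_max_of_le_left (hB ⟨α, hα, rfl⟩)

theorem tsum_row_chan_succ (ν : C) (k : ℕ) (x : A → ℂ) :
    ∑' β, (G.L (G.chan ν (k + 1)) β : ℂ) * x β =
      (G.L (G.chan ν (k + 1)) (G.chan ν k) : ℂ) * x (G.chan ν k) +
      (G.L (G.chan ν (k + 1)) (G.chan ν (k + 1)) : ℂ) * x (G.chan ν (k + 1)) +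
      (G.L (G.chan ν (k + 1)) (G.chan ν (k + 2)) : ℂ) * x (G.chan ν (k + 2)) := by
  classical
  have inj := G.chan_injective ν
  rw [tsum_eq_sum (s := {G.chan ν k, G.chan ν (k + 1), G.chan ν (k + 2)}),
    Finset.sum_insert, Finset.sum_insert, Finset.sum_singleton, add_assoc]
  · simp [inj.eq_iff]
  · simp [inj.eq_iff]
  · intro β hβ
    have : G.L (G.chan ν (k + 1)) β = 0 := by
      by_contra h
      exact hβ (by simpa using G.L_chan_succ_ne_zero h)
    simp [this]

theorem tsum_row_of_stabilizesFrom {K₀ : ℕ} (hstab : G.StabilizesFrom K₀) (ν : C) {k : ℕ}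
    (hk : K₀ ≤ k) (x : A → ℂ) :
    ∑' β, (G.L (G.chan ν (k + 1)) β : ℂ) * x β =
      2 * x (G.chan ν (k + 1)) - x (G.chan ν k) - x (G.chan ν (k + 2)) := by
  have hs := hstab ν k hk
  have hs' := hstab ν (k + 1) (by omega)
  simp only [b, a] at hs hs'
  rw [tsum_row_chan_succ, G.L_symm _ (G.chan ν k), hs'.2, neg_eq_iff_eq_neg.mp hs.1,
    neg_eq_iff_eq_neg.mp hs'.1]
  push_cast
  ring

variable {G}

theorem IsSolution.exists_hasDerivWithinAt {u : ℝ → lp (fun _ : A => ℂ) 2} (hu : G.IsSolution u)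
    {t : ℝ} (ht : t ∈ Set.Icc (0 : ℝ) 1) :
    ∃ u' : lp (fun _ : A => ℂ) 2, HasDerivWithinAt u u' (Set.Icc 0 1) t ∧
      ∀ α, u' α = Complex.I * ∑' β, (G.L α β : ℂ) * u t β := by
  have hd := ((hu.contDiffOn.differentiableOn one_ne_zero) t ht).hasDerivWithinAt
  refine ⟨_, hd, fun α => ?_⟩
  have h1 := ((lp.evalCLM ℝ (fun _ : A => ℂ) 2 α).hasFDerivAt).comp_hasDerivWithinAt t hd
  exact (uniqueDiffOn_Icc zero_lt_one t ht).eq_deriv _ h1 (hu.hasDeriv t ht α)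

/-! ### Propagation of decay along a channel -/

/-- Exponential decay of any rate along a channel propagates in time. Since `L` only couples
neighbours along the channel, the weights `ρ ^ min k N` change by a factor at most `ρ` under `L`, so
Grönwall's inequality in `ℓ^∞` gives a bound that does not depend on the cut-off `N`. -/
theorem IsSolution.decay_propagates [Finite C] {K₀ : ℕ} (hstab : G.StabilizesFrom K₀)
    {u : ℝ → lp (fun _ : A => ℂ) 2} (hu : G.IsSolution u) (ν : C) {ρ M₀ : ℝ} (hρ : 1 ≤ ρ)
    (h0 : ∀ k, ρ ^ k * ‖u 0 (G.chan ν k)‖ ≤ M₀) :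
    ∃ M, ∀ t ∈ Set.Icc (0 : ℝ) 1, ∀ k, ρ ^ k * ‖u t (G.chan ν k)‖ ≤ M := by
  obtain ⟨B, hB0, hB⟩ := G.exists_row_bound hstab
  have inj := G.chan_injective ν
  have hρ0 : 0 ≤ ρ := by linarith
  -- the position along the channel, and `0` off the channel
  set pos : A → ℕ := Function.extend (G.chan ν) id 0 with hpos
  have pos_chan : ∀ k, pos (G.chan ν k) = k := fun k => inj.extend_apply _ _ _
  have pos_off : ∀ α, α ∉ Set.range (G.chan ν) → pos α = 0 := fun α hα =>
    Function.extend_apply' _ _ _ hα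
  have pos_le : ∀ α β, G.L α β ≠ 0 → pos α ≤ pos β + 1 := by
    intro α β h
    by_cases hα : α ∈ Set.range (G.chan ν)
    · obtain ⟨k, rfl⟩ := hα
      by_cases hβ : β ∈ Set.range (G.chan ν)
      · obtain ⟨n, rfl⟩ := hβ
        rw [pos_chan, pos_chan]
        exact (G.near_of_L_ne_zero h).2
      · rw [pos_chan]
        by_contra! hk
        exact h (G.outside ν k (by omega) β hβ)
    · rw [pos_off α hα]
      omega
  refine ⟨max M₀ ‖u 0‖ * Real.exp (ρ * B), fun t ht N => ?_⟩
  set w : A → ℝ := fun α => ρ ^ min (pos α) N with hw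
  have hw0 : ∀ α, 0 ≤ w α := fun α => by positivity
  have hww : ∀ α β, G.L α β ≠ 0 → w α ≤ ρ * w β := by
    intro α β h
    have := pos_le α β h
    rw [hw, ← pow_succ']
    exact pow_le_pow_right₀ hρ (by omega)
  obtain ⟨D, hD⟩ := exists_mul_l2_to_linfty w (W := ρ ^ N) (by positivity) (fun α => by
    rw [abs_of_nonneg (hw0 α)]
    exact pow_le_pow_right₀ hρ (by omega))
  have hnD : ∀ x α, ‖D x α‖ = w α * ‖x α‖ := fun x α => by
    rw [hD, norm_mul, Complex.norm_real, Real.norm_of_nonneg (hw0 α)]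
  have hexd : ∀ t, ∃ u' : lp (fun _ : A => ℂ) 2, t ∈ Set.Icc (0 : ℝ) 1 →
      (HasDerivWithinAt u u' (Set.Icc 0 1) t ∧
      ∀ α, u' α = Complex.I * ∑' β, (G.L α β : ℂ) * u t β) := by
    intro t
    by_cases ht : t ∈ Set.Icc (0 : ℝ) 1
    · obtain ⟨u', h⟩ := hu.exists_hasDerivWithinAt ht
      exact ⟨u', fun _ => h⟩
    · exact ⟨0, fun h => absurd h ht⟩
  choose u' hu' using hexd
  have hg := norm_le_gronwallBound_of_norm_deriv_right_le (f := fun t => D (u t))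
    (f' := fun t => D (u' t)) (δ := max M₀ ‖u 0‖) (K := ρ * B) (ε := 0) (a := 0) (b := 1)
    (D.continuous.comp_continuousOn hu.contDiffOn.continuousOn)
    (fun t ht => (hasDerivWithinAt_l2_to_linfty
      (hu' t (Set.Ico_subset_Icc_self ht)).1).mono_of_mem_nhdsWithin (Icc_mem_nhdsGE_of_mem ht))
    (by
      refine lp.norm_le_of_forall_le (le_max_of_le_right (norm_nonneg _)) fun α => ?_
      rw [hnD]
      by_cases hα : α ∈ Set.range (G.chan ν)
      · obtain ⟨k, rfl⟩ := hα
        refine le_max_of_le_left (le_trans ?_ (h0 k))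
        refine mul_le_mul_of_nonneg_right (pow_le_pow_right₀ hρ ?_) (norm_nonneg _)
        rw [pos_chan]
        omega
      · refine le_max_of_le_right ?_
        simp only [hw, pos_off α hα]
        simpa using lp.norm_apply_le_norm two_ne_zero (u 0) α)
    (fun t ht => by
      rw [add_zero]
      refine lp.norm_le_of_forall_le (by positivity) fun α => ?_
      obtain ⟨s, hs, hsum⟩ := hB α
      rw [hnD, (hu' t (Set.Ico_subset_Icc_self ht)).2 α, norm_mul, Complex.norm_I, one_mul,
        tsum_eq_sum (s := s) (fun β hβ => by simp [hs β hβ])]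
      calc _ ≤ w α * ∑ β ∈ s, ‖(G.L α β : ℂ) * u t β‖ :=
            mul_le_mul_of_nonneg_left (norm_sum_le _ _) (hw0 α)
        _ = ∑ β ∈ s, w α * ‖(G.L α β : ℂ) * u t β‖ := Finset.mul_sum ..
        _ ≤ ∑ β ∈ s, |G.L α β| * (ρ * ‖D (u t)‖) := by
            refine Finset.sum_le_sum fun β _ => ?_
            by_cases h : G.L α β = 0
            · simp [h]
            · have h1 := lp.norm_apply_le_norm (by simp) (D (u t)) β
              rw [hnD] at h1
              rw [norm_mul, Complex.norm_real, Real.norm_eq_abs]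
              calc _ = |G.L α β| * (w α * ‖u t β‖) := by ring
                _ ≤ |G.L α β| * (ρ * w β * ‖u t β‖) := by
                    gcongr
                    exact hww α β h
                _ = |G.L α β| * (ρ * (w β * ‖u t β‖)) := by ring
                _ ≤ _ := by gcongr
        _ = (∑ β ∈ s, |G.L α β|) * (ρ * ‖D (u t)‖) := (Finset.sum_mul ..).symm
        _ ≤ B * (ρ * ‖D (u t)‖) := by gcongr
        _ = _ := by ring) t ht
  rw [gronwallBound_ε0] at hg
  have h1 := (lp.norm_apply_le_norm (by simp) (D (u t)) (G.chan ν N)).trans hg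
  rw [hnD] at h1
  simp only [hw, pos_chan, min_self] at h1
  refine h1.trans ?_
  have := ht.2
  have hM : 0 ≤ max M₀ ‖u 0‖ := le_max_of_le_right (norm_nonneg _)
  refine mul_le_mul_of_nonneg_left (Real.exp_le_exp.mpr ?_) hM
  rw [sub_zero]
  exact mul_le_of_le_one_right (by positivity) this

end WebLikeGraph

/-! ### Generating functions -/

/-- Summation by parts for the free discrete Laplacian on a half-line against the powers of `z`. -/
theorem sum_laplacian_mul_pow (v : ℕ → ℂ) {z : ℂ} (hz : z ≠ 0) (N : ℕ) :
    ∑ k ∈ Finset.range N, (2 * v (k + 1) - v k - v (k + 2)) * z ^ k =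
      (2 - z - z⁻¹) * ∑ k ∈ Finset.range N, v (k + 1) * z ^ k - v 0 + z⁻¹ * v 1 +
        (v N * z ^ N - z⁻¹ * (v (N + 1) * z ^ N)) := by
  induction N with
  | zero => simp
  | succ N ih =>
    rw [Finset.sum_range_succ, ih, Finset.sum_range_succ]
    field_simp
    ring

theorem summable_norm_mul_pow_of_decay {a : ℕ → ℂ} {M r : ℝ} (hr : 0 ≤ r)
    (ha : ∀ k, (2 * r) ^ k * ‖a k‖ ≤ M) : Summable fun k => ‖a k‖ * r ^ k := by
  refine Summable.of_nonneg_of_le (fun k => by positivity) (fun k => ?_)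
    (summable_geometric_two.mul_left M)
  have := mul_le_mul_of_nonneg_right (ha k) (pow_nonneg (one_half_pos (α := ℝ)).le k)
  refine le_trans (le_of_eq ?_) this
  rw [mul_right_comm, ← mul_pow, mul_comm 2 r, mul_assoc, mul_one_div_cancel two_ne_zero, mul_one,
    mul_comm]

/-- Let `v` solve the free half-line equation with a boundary term, and let `w₀`, `w₁` solve the
inhomogeneous scalar equations with right-hand sides `v 0`, `v 1`. Then the combination of the
generating function of `v` with `w₀` and `w₁` that removes the boundary terms satisfies a
homogeneous equation, and therefore evolves by the factor `exp (i (2 - z - 1 / z) t)`. -/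
theorem exp_mul_generating_function_eq {v : ℕ → ℝ → ℂ} {w₀ w₁ : ℝ → ℂ} {z : ℂ} {M : ℝ}
    (hz : z ≠ 0)
    (hv : ∀ k, ∀ t ∈ Set.Icc (0 : ℝ) 1, HasDerivWithinAt (v (k + 1))
      (Complex.I * (2 * v (k + 1) t - v k t - v (k + 2) t)) (Set.Icc 0 1) t)
    (hw₀ : ∀ t ∈ Set.Icc (0 : ℝ) 1, HasDerivWithinAt w₀
      (Complex.I * ((2 - z - z⁻¹) * w₀ t - v 0 t)) (Set.Icc 0 1) t)
    (hw₁ : ∀ t ∈ Set.Icc (0 : ℝ) 1, HasDerivWithinAt w₁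
      (Complex.I * ((2 - z - z⁻¹) * w₁ t - v 1 t)) (Set.Icc 0 1) t)
    (hM : ∀ t ∈ Set.Icc (0 : ℝ) 1, ∀ k, (2 * ‖z‖) ^ k * ‖v k t‖ ≤ M)
    {t : ℝ} (ht : t ∈ Set.Icc (0 : ℝ) 1) :
    Complex.exp (-(Complex.I * (2 - z - z⁻¹)) * t) *
        (∑' k, v (k + 1) t * z ^ k - w₀ t + z⁻¹ * w₁ t) =
      ∑' k, v (k + 1) 0 * z ^ k - w₀ 0 + z⁻¹ * w₁ 0 := by
  set l : ℂ := 2 - z - z⁻¹ with hl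
  have hz0 : 0 < ‖z‖ := norm_pos_iff.mpr hz
  -- The partial sums satisfy the homogeneous equation up to two terms that tend to zero uniformly
  -- in `t`, so no termwise differentiation of the series is needed.
  set Q : ℕ → ℝ → ℂ := fun N t => Complex.exp (-(Complex.I * l) * t) *
    (∑ k ∈ Finset.range N, v (k + 1) t * z ^ k - w₀ t + z⁻¹ * w₁ t) with hQ
  have hE : ∀ t : ℝ, HasDerivAt (fun t : ℝ => Complex.exp (-(Complex.I * l) * t))
      (Complex.exp (-(Complex.I * l) * t) * (-(Complex.I * l))) t := by
    intro t
    have h1 : HasDerivAt (fun t : ℝ => -(Complex.I * l) * (t : ℂ)) (-(Complex.I * l)) t := by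
      simpa using (Complex.ofRealCLM.hasDerivAt (x := t)).const_mul (-(Complex.I * l))
    exact h1.cexp
  have hQd : ∀ N, ∀ t ∈ Set.Icc (0 : ℝ) 1, HasDerivWithinAt (Q N)
      (Complex.exp (-(Complex.I * l) * t) * (Complex.I *
        (v N t * z ^ N - z⁻¹ * (v (N + 1) t * z ^ N)))) (Set.Icc 0 1) t := by
    intro N t ht
    have hS : HasDerivWithinAt (fun t => ∑ k ∈ Finset.range N, v (k + 1) t * z ^ k)
        (∑ k ∈ Finset.range N, Complex.I * (2 * v (k + 1) t - v k t - v (k + 2) t) * z ^ k)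
        (Set.Icc 0 1) t :=
      HasDerivWithinAt.fun_sum fun k _ => (hv k t ht).mul_const _
    have := (hE t).hasDerivWithinAt (s := Set.Icc 0 1) |>.mul
      ((hS.sub (hw₀ t ht)).add ((hw₁ t ht).const_mul z⁻¹))
    refine this.congr_deriv ?_
    have hs := sum_laplacian_mul_pow (fun k => v k t) hz N
    simp only [mul_assoc, ← Finset.mul_sum]
    simp only [Pi.sub_apply, Pi.add_apply]
    rw [hs, ← hl]
    ring
  have hMs : ∀ t ∈ Set.Icc (0 : ℝ) 1, ∀ k, ‖z‖ ^ k * ‖v k t‖ ≤ M * (1 / 2) ^ k := by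
    intro t ht k
    have := mul_le_mul_of_nonneg_right (hM t ht k) (pow_nonneg (one_half_pos (α := ℝ)).le k)
    refine le_trans (le_of_eq ?_) this
    rw [mul_right_comm, ← mul_pow, mul_comm 2 ‖z‖, mul_assoc, mul_one_div_cancel two_ne_zero,
      mul_one]
  have hM0 : 0 ≤ M := le_trans (by positivity) (hM t ht 0)
  set K : ℝ := Real.exp ‖Complex.I * l‖ * (M + ‖z‖⁻¹ * ‖z‖⁻¹ * M) with hK
  have hbd : ∀ N, ‖Q N t - Q N 0‖ ≤ K * (1 / 2) ^ N := by
    intro N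
    have := norm_image_sub_le_of_norm_deriv_le_segment' (hQd N) (C := K * (1 / 2) ^ N)
      (fun s hs => by
        have hs' := Set.Ico_subset_Icc_self hs
        rw [norm_mul, norm_mul, Complex.norm_I, one_mul, hK, mul_assoc]
        have h1 : ‖Complex.exp (-(Complex.I * l) * s)‖ ≤ Real.exp ‖Complex.I * l‖ := by
          rw [Complex.norm_exp]
          refine Real.exp_le_exp.mpr ((Complex.re_le_norm _).trans ?_)
          rw [norm_mul, norm_neg, Complex.norm_real, Real.norm_of_nonneg hs.1]
          exact mul_le_of_le_one_right (norm_nonneg _) hs'.2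
        have h2 : ‖v N s * z ^ N‖ ≤ M * (1 / 2) ^ N := by
          rw [norm_mul, norm_pow, mul_comm]
          exact hMs s hs' N
        have h3 : ‖z⁻¹ * (v (N + 1) s * z ^ N)‖ ≤ ‖z‖⁻¹ * ‖z‖⁻¹ * M * (1 / 2) ^ N := by
          have h4 := hMs s hs' (N + 1)
          rw [norm_mul, norm_mul, norm_pow, norm_inv]
          calc _ = ‖z‖⁻¹ * ‖z‖⁻¹ * (‖z‖ ^ (N + 1) * ‖v (N + 1) s‖) := by
                field_simp
                ring
            _ ≤ ‖z‖⁻¹ * ‖z‖⁻¹ * (M * (1 / 2) ^ N) := by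
                refine mul_le_mul_of_nonneg_left (h4.trans ?_) (by positivity)
                refine mul_le_mul_of_nonneg_left ?_ hM0
                exact pow_le_pow_of_le_one (by norm_num) (by norm_num) (by omega)
            _ = _ := by ring
        refine mul_le_mul h1 ?_ (norm_nonneg _) (Real.exp_pos _).le
        refine (norm_sub_le _ _).trans ((add_le_add h2 h3).trans_eq ?_)
        ring) t ht
    refine this.trans ?_
    rw [sub_zero]
    exact mul_le_of_le_one_right (by positivity) ht.2
  have hsum : ∀ t ∈ Set.Icc (0 : ℝ) 1, Summable fun k => v (k + 1) t * z ^ k := by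
    intro t ht
    have := (summable_nat_add_iff 1).mpr (summable_norm_mul_pow_of_decay hz0.le (hM t ht))
    refine Summable.of_norm ?_
    refine (this.mul_left ‖z‖⁻¹).congr fun k => ?_
    rw [norm_mul, norm_pow, pow_succ]
    field_simp
  have hlim : ∀ t ∈ Set.Icc (0 : ℝ) 1, Filter.Tendsto (fun N => Q N t) Filter.atTop
      (nhds (Complex.exp (-(Complex.I * l) * t) *
        (∑' k, v (k + 1) t * z ^ k - w₀ t + z⁻¹ * w₁ t))) := by
    intro t ht
    exact ((((hsum t ht).hasSum.tendsto_sum_nat).sub_const _).add_const _).const_mul _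
  have h0 : (0 : ℝ) ∈ Set.Icc (0 : ℝ) 1 := ⟨le_rfl, zero_le_one⟩
  have hz1 : Filter.Tendsto (fun N => Q N t - Q N 0) Filter.atTop (nhds 0) := by
    refine squeeze_zero_norm hbd ?_
    have := (tendsto_pow_atTop_nhds_zero_of_lt_one (r := (1 / 2 : ℝ)) (by norm_num)
      (by norm_num)).const_mul K
    simpa using this
  have := tendsto_nhds_unique ((hlim t ht).sub (hlim 0 h0)) hz1
  simpa [sub_eq_zero] using this

theorem hasFPowerSeriesOnBall_tsum_mul_pow {a : ℕ → ℂ}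
    (ha : ∀ r : ℝ, 0 ≤ r → Summable fun k => ‖a k‖ * r ^ k) :
    HasFPowerSeriesOnBall (fun z => ∑' k, a k * z ^ k)
      (FormalMultilinearSeries.ofScalars ℂ a) 0 ⊤ := by
  have hr : (FormalMultilinearSeries.ofScalars ℂ a).radius = ⊤ := by
    refine FormalMultilinearSeries.radius_eq_top_of_summable_norm _ fun r => ?_
    simpa [FormalMultilinearSeries.ofScalars_norm] using ha r r.2
  have := (FormalMultilinearSeries.ofScalars ℂ a).hasFPowerSeriesOnBall (by rw [hr]; simp)
  rw [hr] at this
  convert this using 1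
  ext z
  simp [FormalMultilinearSeries.sum, mul_comm]

theorem differentiable_tsum_mul_pow {a : ℕ → ℂ}
    (ha : ∀ r : ℝ, 0 ≤ r → Summable fun k => ‖a k‖ * r ^ k) :
    Differentiable ℂ fun z => ∑' k, a k * z ^ k := by
  have := (hasFPowerSeriesOnBall_tsum_mul_pow ha).differentiableOn
  simpa [differentiableOn_univ] using this

theorem coeff_eq_zero_of_tsum_mul_pow_eq_zero {a : ℕ → ℂ}
    (ha : ∀ r : ℝ, 0 ≤ r → Summable fun k => ‖a k‖ * r ^ k)
    (h : ∀ z, ∑' k, a k * z ^ k = 0) (k : ℕ) : a k = 0 := by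
  have h1 := (hasFPowerSeriesOnBall_tsum_mul_pow ha).hasFPowerSeriesAt
  have h2 : (fun z => ∑' k, a k * z ^ k) = (0 : ℂ → ℂ) := funext h
  rw [h2] at h1
  exact congrFun ((FormalMultilinearSeries.ofScalars_series_eq_zero ℂ).mp h1.eq_zero) k

theorem exp_mul_div_pow_le {x : ℝ} (hx : 0 ≤ x) {n : ℕ} (hn : 0 < n) :
    (Real.exp 1 * x / n) ^ n ≤ Real.exp x := by
  have hn' : (0 : ℝ) < n := by exact_mod_cast hn
  have h1 : Real.exp 1 * x / n ≤ Real.exp (x / n) := by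
    have := Real.add_one_le_exp (x / n - 1)
    rw [sub_add_cancel, Real.exp_sub, le_div_iff₀ (Real.exp_pos 1)] at this
    refine le_trans (le_of_eq ?_) this
    ring
  calc _ ≤ Real.exp (x / n) ^ n := by gcongr
    _ = _ := by rw [← Real.exp_nat_mul]; congr 1; field_simp

/-- Coefficients bounded by `(e / (s n)) ^ n` give a power series of exponential type at most
`1 / s'`, for every `s' < s`. The shift by `K` only helps for `1 ≤ ‖z‖`. -/
theorem norm_tsum_mul_pow_le {a : ℕ → ℂ} {c s s' : ℝ} (hc : 0 ≤ c) (hs' : 0 < s') (hs : s' < s)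
    {K : ℕ} (ha : ∀ k, ‖a k‖ ≤ c * (Real.exp 1 / (s * ((K + k + 1 : ℕ) : ℝ))) ^ (K + k + 1))
    {z : ℂ} (hz : 1 ≤ ‖z‖) :
    ‖∑' k, a k * z ^ k‖ ≤ c * (1 - s' / s)⁻¹ * Real.exp (s'⁻¹ * ‖z‖) := by
  have hs0 : 0 < s := hs'.trans hs
  have hq0 : 0 ≤ s' / s := by positivity
  have hq1 : s' / s < 1 := (div_lt_one hs0).mpr hs
  have hg := ((hasSum_geometric_of_lt_one hq0 hq1).mul_left c).mul_right (Real.exp (s'⁻¹ * ‖z‖))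
  refine tsum_of_norm_bounded hg fun k => ?_
  rw [norm_mul, norm_pow]
  have hn : (0 : ℝ) < ((K + k + 1 : ℕ) : ℝ) := by positivity
  calc _ ≤ c * (Real.exp 1 / (s * ((K + k + 1 : ℕ) : ℝ))) ^ (K + k + 1) * ‖z‖ ^ (K + k + 1) := by
        refine mul_le_mul (ha k) (pow_le_pow_right₀ hz (by omega)) (by positivity) (by positivity)
    _ = c * (s' / s) ^ (K + k + 1) *
          (Real.exp 1 * (s'⁻¹ * ‖z‖) / ((K + k + 1 : ℕ) : ℝ)) ^ (K + k + 1) := by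
        rw [mul_assoc, mul_assoc, ← mul_pow, ← mul_pow]
        congr 2
        field_simp
    _ ≤ c * (s' / s) ^ k * Real.exp (s'⁻¹ * ‖z‖) := by
        refine mul_le_mul (mul_le_mul_of_nonneg_left ?_ hc)
          (exp_mul_div_pow_le (by positivity) (by omega)) (by positivity) (by positivity)
        exact pow_le_pow_of_le_one hq0 hq1.le (by omega)

/-! ### The resolvent at `2 - z - 1 / z` -/

theorem tendsto_two_sub_sub_inv_cobounded :
    Filter.Tendsto (fun z : ℂ => 2 - z - z⁻¹) (Bornology.cobounded ℂ) (Bornology.cobounded ℂ) := by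
  rw [← tendsto_norm_atTop_iff_cobounded]
  refine Filter.tendsto_atTop_mono' _ (f₁ := fun z : ℂ => ‖z‖ - 3) ?_
    (Filter.tendsto_atTop_add_const_right _ _ tendsto_norm_cobounded_atTop)
  filter_upwards [(tendsto_norm_cobounded_atTop (E := ℂ)).eventually_ge_atTop 1] with z hz
  have h1 : ‖z⁻¹‖ ≤ 1 := by
    rw [norm_inv]
    exact inv_le_one_of_one_le₀ hz
  have h2 : z = 2 - (2 - z - z⁻¹) - z⁻¹ := by ring
  have h3 : ‖z‖ ≤ 2 + ‖2 - z - z⁻¹‖ + ‖z⁻¹‖ := by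
    conv_lhs => rw [h2]
    refine (norm_sub_le _ _).trans (add_le_add_left ((norm_sub_le _ _).trans ?_) _)
    simp
  show ‖z‖ - 3 ≤ ‖2 - z - z⁻¹‖
  linarith

/-- Far from the origin, `2 - z - 1 / z` lies in the resolvent set of a given operator and the
resolvent there is a contraction. -/
theorem exists_radius_resolvent {E : Type*} [NormedAddCommGroup E] [NormedSpace ℂ E]
    [CompleteSpace E] (T : E →L[ℂ] E) :
    ∃ R : ℝ, 1 ≤ R ∧ ∀ z : ℂ, R < ‖z‖ →
      2 - z - z⁻¹ ∈ resolventSet ℂ T ∧ ‖resolvent T (2 - z - z⁻¹)‖ ≤ 1 := by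
  have h1 : ∀ᶠ l in Bornology.cobounded ℂ, l ∈ resolventSet ℂ T ∧ ‖resolvent T l‖ ≤ 1 := by
    refine Filter.Eventually.and ?_ ?_
    · filter_upwards [(tendsto_norm_cobounded_atTop (E := ℂ)).eventually_ge_atTop
        (‖T‖ * ‖(1 : E →L[ℂ] E)‖ + 1)] with l hl
      exact spectrum.mem_resolventSet_of_norm_lt_mul (by linarith)
    · have := (spectrum.resolvent_tendsto_cobounded (𝕜 := ℂ) T).norm
      rw [norm_zero] at this
      exact this.eventually_le_const zero_lt_one
  have h2 := tendsto_two_sub_sub_inv_cobounded.eventually h1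
  obtain ⟨R, -, hR⟩ := (Filter.hasBasis_cobounded_norm (E := ℂ)).eventually_iff.mp h2
  exact ⟨max R 1, le_max_right _ _, fun z hz => hR ((le_max_left R 1).trans hz.le)⟩

theorem resolvent_comp_apply {E : Type*} [NormedAddCommGroup E] [NormedSpace ℂ E]
    [CompleteSpace E] {T : E →L[ℂ] E} {l : ℂ} (hl : l ∈ resolventSet ℂ T) (y : E) :
    resolvent T l (T y) = l • resolvent T l y - y := by
  have h := Ring.inverse_mul_cancel _ (spectrum.mem_resolventSet_iff.mp hl)
  have h' := congrArg (fun S : E →L[ℂ] E => S y) h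
  have e : (algebraMap ℂ (E →L[ℂ] E) l - T) y = l • y - T y := by
    rw [Algebra.algebraMap_eq_smul_one]; rfl
  change resolvent T l ((algebraMap ℂ (E →L[ℂ] E) l - T) y) = y at h'
  rw [e, map_sub, map_smul] at h'
  exact eq_sub_of_add_eq (sub_eq_iff_eq_add'.mp h').symm

/-! ### Uniqueness -/

namespace WebLikeGraph

/-- If a solution vanishes on a channel beyond some vertex at all times, then it vanishes on the
whole channel: at the last vertex where this is not yet known, the equation at the next vertex
expresses the value through a non-zero coefficient. -/
theorem IsSolution.eq_zero_of_eq_zero_tail {A C : Type*} {G : WebLikeGraph A C}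
    {u : ℝ → lp (fun _ : A => ℂ) 2} (hu : G.IsSolution u) (ν : C) (m : ℕ)
    (h : ∀ t ∈ Set.Icc (0 : ℝ) 1, ∀ k, m ≤ k → u t (G.chan ν k) = 0) :
    ∀ t ∈ Set.Icc (0 : ℝ) 1, ∀ k, u t (G.chan ν k) = 0 := by
  induction m with
  | zero => exact fun t ht k => h t ht k (Nat.zero_le k)
  | succ m ih =>
    refine ih fun t ht k hk => ?_
    rcases hk.eq_or_lt with rfl | hk
    · have h1 := hu.hasDeriv t ht (G.chan ν (m + 1))
      have h2 : HasDerivWithinAt (fun s => u s (G.chan ν (m + 1))) 0 (Set.Icc 0 1) t :=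
        (hasDerivWithinAt_const t _ (0 : ℂ)).congr (fun s hs => h s hs _ le_rfl) (h t ht _ le_rfl)
      have h3 := (uniqueDiffOn_Icc zero_lt_one t ht).eq_deriv _ h1 h2
      rw [G.tsum_row_chan_succ, h t ht (m + 1) le_rfl, h t ht (m + 2) (by omega)] at h3
      have h4 : G.L (G.chan ν (m + 1)) (G.chan ν m) ≠ 0 := by
        rw [G.L_symm]
        exact G.near ν m
      simpa [h4] using h3
    · exact h t ht k hk

end WebLikeGraph

theorem theorem3p2 {A C : Type*} [Finite C] (G : WebLikeGraph A C)
    (K₀ : ℕ) (hK₀ : 0 < K₀) (hstab : G.StabilizesFrom K₀)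
    (u : ℝ → lp (fun _ : A => ℂ) 2) (hu : G.IsSolution u)
    (ν₀ : C) (ε : ℝ) (hε : 0 < ε) (c : ℝ)
    (hdecay : ∀ t : ℝ, t = 0 ∨ t = 1 → ∀ k : ℕ, 0 < k →
      ‖u t (G.chan ν₀ k)‖ ≤ c * (Real.exp 1 / ((2 + ε) * k)) ^ k) :
    ∀ t ∈ Set.Icc (0 : ℝ) 1, ∀ k : ℕ, u t (G.chan ν₀ k) = 0 := by
  have m0 : (0 : ℝ) ∈ Set.Icc (0 : ℝ) 1 := ⟨le_rfl, zero_le_one⟩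
  have m1 : (1 : ℝ) ∈ Set.Icc (0 : ℝ) 1 := ⟨zero_le_one, le_rfl⟩
  have hc : 0 ≤ c := by
    have h := (norm_nonneg _).trans (hdecay 0 (Or.inl rfl) 1 one_pos)
    exact nonneg_of_mul_nonneg_left h (by positivity)
  -- superexponential decay along the channel at all times
  have hprop : ∀ ρ : ℝ, 1 ≤ ρ →
      ∃ M, ∀ t ∈ Set.Icc (0 : ℝ) 1, ∀ k, ρ ^ k * ‖u t (G.chan ν₀ k)‖ ≤ M := by
    intro ρ hρ
    refine hu.decay_propagates hstab ν₀ hρ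
      (M₀ := max ‖u 0 (G.chan ν₀ 0)‖ (c * Real.exp (ρ / (2 + ε)))) fun k => ?_
    rcases k.eq_zero_or_pos with rfl | hk
    · simp
    · refine le_max_of_le_right ?_
      have hk' : (0 : ℝ) < k := by exact_mod_cast hk
      calc _ ≤ ρ ^ k * (c * (Real.exp 1 / ((2 + ε) * k)) ^ k) := by
            gcongr
            exact hdecay 0 (Or.inl rfl) k hk
        _ = c * (Real.exp 1 * (ρ / (2 + ε)) / k) ^ k := by
            rw [mul_left_comm, ← mul_pow]
            congr 2
            field_simp
        _ ≤ _ := by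
            gcongr
            exact exp_mul_div_pow_le (by positivity) hk
  have hproptail : ∀ ρ : ℝ, 1 ≤ ρ →
      ∃ M, ∀ t ∈ Set.Icc (0 : ℝ) 1, ∀ k m, ρ ^ k * ‖u t (G.chan ν₀ (m + k))‖ ≤ M := by
    intro ρ hρ
    obtain ⟨M, hM⟩ := hprop ρ hρ
    refine ⟨M, fun t ht k m => le_trans ?_ (hM t ht (m + k))⟩
    exact mul_le_mul_of_nonneg_right (pow_le_pow_right₀ hρ (by omega)) (norm_nonneg _)
  have hsummable : ∀ t ∈ Set.Icc (0 : ℝ) 1, ∀ r : ℝ, 0 ≤ r →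
      Summable fun k => ‖u t (G.chan ν₀ (K₀ + k + 1))‖ * r ^ k := by
    intro t ht r hr
    obtain ⟨M, hM⟩ := hproptail (2 * r + 1) (by linarith)
    refine summable_norm_mul_pow_of_decay (M := M) hr fun k => le_trans ?_ (hM t ht k (K₀ + 1))
    rw [Nat.add_right_comm]
    gcongr
    linarith
  -- the matrix as an operator on `ℓ^∞`, and its resolvent applied to the solution
  obtain ⟨B, hB0, hB⟩ := G.exists_row_bound hstab
  obtain ⟨T, hT⟩ := exists_linfty_operator G.L hB0 hB
  obtain ⟨J, hJ'⟩ := exists_mul_l2_to_linfty (A := A) (fun _ => 1) zero_le_one (by simp)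
  have hJ : ∀ x α, J x α = x α := fun x α => by simp [hJ']
  obtain ⟨R, hR1, hR⟩ := exists_radius_resolvent T
  set w : ℂ → ℕ → ℝ → ℂ := fun z j t =>
    resolvent T (2 - z - z⁻¹) (J (u t)) (G.chan ν₀ (K₀ + j)) with hw
  have hwle : ∀ z, R < ‖z‖ → ∀ j t, ‖w z j t‖ ≤ ‖J (u t)‖ := by
    intro z hz j t
    refine (lp.norm_apply_le_norm (by simp) _ _).trans
      ((ContinuousLinearMap.le_opNorm _ _).trans ?_)
    exact mul_le_of_le_one_left (norm_nonneg _) (hR z hz).2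
  have hwderiv : ∀ z, R < ‖z‖ → ∀ j, ∀ t ∈ Set.Icc (0 : ℝ) 1, HasDerivWithinAt (w z j)
      (Complex.I * ((2 - z - z⁻¹) * w z j t - u t (G.chan ν₀ (K₀ + j)))) (Set.Icc 0 1) t := by
    intro z hz j t ht
    obtain ⟨u', hu', huα⟩ := hu.exists_hasDerivWithinAt ht
    have h1 := hasDerivWithinAt_l2_to_linfty
      (D := resolvent T (2 - z - z⁻¹) ∘L J) hu'
    have h2 := ((lp.evalCLM ℝ (fun _ : A => ℂ) ⊤
      (G.chan ν₀ (K₀ + j))).hasFDerivAt).comp_hasDerivWithinAt t h1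
    refine h2.congr_deriv ?_
    have h3 : J u' = Complex.I • T (J (u t)) := by
      ext α
      rw [hJ, huα, lp.coeFn_smul, Pi.smul_apply, hT, smul_eq_mul]
      simp only [hJ]
    show (resolvent T (2 - z - z⁻¹) (J u')) (G.chan ν₀ (K₀ + j)) = _
    rw [h3, map_smul, resolvent_comp_apply (hR z hz).1]
    simp only [lp.coeFn_smul, lp.coeFn_sub, Pi.smul_apply, Pi.sub_apply, smul_eq_mul, hJ, hw]
  -- the generating function along the channel, and its combination with the resolvent terms that
  -- removes the boundary terms of the equation
  set Φ : ℝ → ℂ → ℂ := fun t z => ∑' k, u t (G.chan ν₀ (K₀ + k + 1)) * z ^ k with hΦ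
  set H : ℝ → ℂ → ℂ := fun t z => Φ t z - w z 0 t + z⁻¹ * w z 1 t with hH
  have hcons : ∀ z, R < ‖z‖ → ∀ t ∈ Set.Icc (0 : ℝ) 1,
      Complex.exp (-(Complex.I * (2 - z - z⁻¹)) * t) * H t z = H 0 z := by
    intro z hz t ht
    obtain ⟨M, hM⟩ := hproptail (2 * ‖z‖) (by linarith)
    refine exp_mul_generating_function_eq (v := fun k t => u t (G.chan ν₀ (K₀ + k)))
      (w₀ := w z 0) (w₁ := w z 1) (z := z) (M := M) (norm_pos_iff.mp (by linarith))
      (fun k t ht => ?_) (hwderiv z hz 0) (hwderiv z hz 1) (fun t ht k => hM t ht k K₀) ht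
    have := hu.hasDeriv t ht (G.chan ν₀ (K₀ + k + 1))
    rwa [G.tsum_row_of_stabilizesFrom hstab ν₀ (Nat.le_add_right K₀ k)] at this
  set D : ℝ := c * (1 - (2 + ε / 2) / (2 + ε))⁻¹ + 2 * max ‖J (u 0)‖ ‖J (u 1)‖ with hD
  -- `2 + ε / 2` lies strictly between `2` and `2 + ε`: the loss pays for the sum of the series, and
  -- the type stays below `1 / 2`
  have htype : ∀ t : ℝ, t = 0 ∨ t = 1 → ∀ z, R < ‖z‖ →
      ‖H t z‖ ≤ D * Real.exp ((2 + ε / 2)⁻¹ * ‖z‖) := by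
    intro t ht z hz
    have h1 : ‖Φ t z‖ ≤ c * (1 - (2 + ε / 2) / (2 + ε))⁻¹ * Real.exp ((2 + ε / 2)⁻¹ * ‖z‖) :=
      norm_tsum_mul_pow_le hc (by linarith) (by linarith) (K := K₀)
        (fun k => hdecay t ht (K₀ + k + 1) (by omega)) (by linarith)
    have hm : ‖J (u t)‖ ≤ max ‖J (u 0)‖ ‖J (u 1)‖ := by
      rcases ht with rfl | rfl
      · exact le_max_left _ _
      · exact le_max_right _ _
    have h2 := (hwle z hz 0 t).trans hm
    have h3 : ‖z⁻¹ * w z 1 t‖ ≤ max ‖J (u 0)‖ ‖J (u 1)‖ := by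
      rw [norm_mul, norm_inv]
      refine (mul_le_of_le_one_left (norm_nonneg _) ?_).trans ((hwle z hz 1 t).trans hm)
      exact inv_le_one_of_one_le₀ (by linarith)
    have h4 : 1 ≤ Real.exp ((2 + ε / 2)⁻¹ * ‖z‖) := Real.one_le_exp (by positivity)
    have h5 : 0 ≤ max ‖J (u 0)‖ ‖J (u 1)‖ := le_max_of_le_left (norm_nonneg _)
    have h6 : ‖H t z‖ ≤ ‖Φ t z‖ + ‖w z 0 t‖ + ‖z⁻¹ * w z 1 t‖ :=
      (norm_add_le _ _).trans (add_le_add_left (norm_sub_le _ _) _)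
    rw [hD, add_mul]
    nlinarith
  have hdiff : DifferentiableOn ℂ (H 0) {z | R < ‖z‖} := by
    intro z hz
    have hz' : R < ‖z‖ := hz
    have hz0 : z ≠ 0 := norm_pos_iff.mp (by linarith)
    have hinv : DifferentiableAt ℂ (fun z : ℂ => z⁻¹) z := differentiableAt_inv hz0
    have hwd : ∀ j, DifferentiableAt ℂ (fun z => w z j 0) z := by
      intro j
      have hl : DifferentiableAt ℂ (fun z : ℂ => 2 - z - z⁻¹) z := by fun_prop (disch := exact hz0)
      have h1 : DifferentiableAt ℂ (fun z => resolvent T (2 - z - z⁻¹)) z :=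
        DifferentiableAt.comp (g := resolvent T) z
          (spectrum.hasDerivAt_resolvent_const_left (hR z hz').1).differentiableAt hl
      have h2 : DifferentiableAt ℂ (fun z => resolvent T (2 - z - z⁻¹) (J (u 0))) z :=
        h1.clm_apply (differentiableAt_const _)
      exact ((lp.evalCLM ℂ (fun _ : A => ℂ) ⊤
        (G.chan ν₀ (K₀ + j))).differentiableAt).comp z h2
    exact ((((differentiable_tsum_mul_pow (hsummable 0 m0)) z).sub (hwd 0)).add
      (hinv.mul (hwd 1))).differentiableWithinAt
  have hH0 : ∀ z, R < ‖z‖ → H 0 z = 0 := by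
    refine eq_zero_of_type_lt_half (D := D) (σ := (2 + ε / 2)⁻¹) hR1 hdiff (by positivity) ?_
      (htype 0 (Or.inl rfl)) fun z hz => ?_
    · rw [one_div]
      exact inv_strictAnti₀ two_pos (by linarith)
    · rw [← hcons z hz 1 m1, ← mul_assoc, ← Complex.exp_add]
      simpa using htype 1 (Or.inr rfl) z hz
  have hHt : ∀ t ∈ Set.Icc (0 : ℝ) 1, ∀ z, R < ‖z‖ → H t z = 0 := by
    intro t ht z hz
    have := hcons z hz t ht
    rw [hH0 z hz] at this
    exact (mul_eq_zero.mp this).resolve_left (Complex.exp_ne_zero _)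
  -- the generating function vanishes at infinity, hence everywhere
  have hΦ0 : ∀ t ∈ Set.Icc (0 : ℝ) 1, ∀ z, Φ t z = 0 := by
    intro t ht z
    refine (differentiable_tsum_mul_pow (hsummable t ht)).apply_eq_of_tendsto_cocompact z ?_
    rw [← Metric.cobounded_eq_cocompact]
    have hres : Filter.Tendsto (fun z : ℂ => ‖resolvent T (2 - z - z⁻¹)‖ * ‖J (u t)‖ * 2)
        (Bornology.cobounded ℂ) (nhds 0) := by
      have := (((spectrum.resolvent_tendsto_cobounded (𝕜 := ℂ) T).comp
        tendsto_two_sub_sub_inv_cobounded).norm.mul_const ‖J (u t)‖).mul_const 2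
      simpa using this
    refine squeeze_zero_norm' ?_ hres
    filter_upwards [(tendsto_norm_cobounded_atTop (E := ℂ)).eventually_ge_atTop (R + 1)] with z hz
    have h1 := hHt t ht z (by linarith)
    have h2 : Φ t z = w z 0 t - z⁻¹ * w z 1 t := by
      linear_combination h1
    have h3 : ∀ j, ‖w z j t‖ ≤ ‖resolvent T (2 - z - z⁻¹)‖ * ‖J (u t)‖ := fun j =>
      (lp.norm_apply_le_norm (by simp) _ _).trans (ContinuousLinearMap.le_opNorm _ _)
    have h4 : ‖z⁻¹ * w z 1 t‖ ≤ ‖w z 1 t‖ := by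
      rw [norm_mul, norm_inv]
      exact mul_le_of_le_one_left (norm_nonneg _) (inv_le_one_of_one_le₀ (by linarith))
    show ‖Φ t z‖ ≤ _
    rw [h2]
    have := norm_sub_le (w z 0 t) (z⁻¹ * w z 1 t)
    linarith [h3 0, h3 1]
  refine hu.eq_zero_of_eq_zero_tail ν₀ (K₀ + 1) fun t ht k hk => ?_
  obtain ⟨j, rfl⟩ := Nat.exists_eq_add_of_le hk
  have := coeff_eq_zero_of_tsum_mul_pow_eq_zero (hsummable t ht) (hΦ0 t ht) j
  rwa [Nat.add_right_comm] at this
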